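/- **Theorem.** Let $k$ be an algebraically closed field (of any characteristic), $F$ any field, and $G=(V,E)$ a graph with finite vertex set $V$, whose edges are unordered pairs $vw$ of distinct vertices; $K(V)$ is the set of all such pairs. The *length-rigidity matroid* is the matroid on $K(V)$ in which a set of pairs is independent iff the corresponding polynomials $(x_v-x_w)^2+(y_v-y_w)^2\in\mathbb{Q}[x_u,y_u : u\in V]$ are algebraically independent over $\mathbb{Q}$. The *slope-rigidity matroid* is the matroid on $K(V)$ in which a set of pairs is independent iff the corresponding rational functions $m_{vw}=(y_w-y_v)/(x_w-x_v)\in F(x_u,y_u : u\in V)$ are algebraically independent over $F$ (for instance $F=\mathbb{Q}$ or $F=k$). Let $\mathrm{Gr}(G)=\prod_{v\in V}\mathbb{P}^2\times\prod_{e\in E}\hat{\mathbb{P}}^2$, where $\mathbb{P}^2$ is the projective plane over $k$ and $\hat{\mathbb{P}}^2$ its dual. The *picture space* $\mathcal{X}(G)$ is the set of $\mathbf{P}\in\mathrm{Gr}(G)$ such that the point $\mathbf{P}(v)$ lies on the line $\mathbf{P}(e)$ whenever $v$ is an endpoint of $e$. The *picture variety* $\mathcal{V}(G)$ is the Zariski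 closure of the set of those $\mathbf{P}\in\mathcal{X}(G)$ whose points $\mathbf{P}(v)$, $v\in V$, are pairwise distinct. With coordinates $[a_0:a_1:a_2]$ on $\mathbb{P}^2$, and $x=a_1/a_0$, $y=a_2/a_0$ on $\mathbb{A}^2=\{a_0\neq 0\}$, the *affine picture variety* $\tilde{\mathcal{V}}(G)$ is the set of $\mathbf{P}\in\mathcal{V}(G)$ such that every point $\mathbf{P}(v)$ lies in $\mathbb{A}^2$ and every line $\mathbf{P}(e)$ has an equation of the form $y=m_e x+b_e$. The *affine slope variety* $\tilde{\mathcal{S}}(G)\subseteq\mathbb{A}^{|E|}=k^E$ is the image of $\tilde{\mathcal{V}}(G)$ under $\mathbf{P}\mapsto(m_e)_{e\in E}$. The following are equivalent: (i) $E$ is independent in the length-rigidity matroid; (ii) $E$ is independent in the slope-rigidity matroid; (iii) $\tilde{\mathcal{S}}(G)=\mathbb{A}^{|E|}$; (iv) $\mathcal{V}(G)=\mathcal{X}(G)$. -/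

import Mathlib

open scoped LinearAlgebra.Projectivization

namespace GraphVariety

noncomputable section

/-- The edge set `K(V)` of the complete graph on `V`: all unordered pairs of distinct vertices. -/
def completeEdges (V : Type*) : Set (Sym2 V) :=
  {e | ¬ e.IsDiag}

/-! ### Coordinates: `(v, 0)` indexes `x_v` and `(v, 1)` indexes `y_v`. -/

/-- The squared length `(x_v - x_w)^2 + (y_v - y_w)^2` of the edge `vw`, a polynomial over `ℚ`. -/
def sqLength (V : Type*) : Sym2 V → MvPolynomial (V × Fin 2) ℚ :=
  Sym2.lift ⟨fun v w =>
    (MvPolynomial.X (v, 0) - MvPolynomial.X (w, 0)) ^ 2 +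
      (MvPolynomial.X (v, 1) - MvPolynomial.X (w, 1)) ^ 2,
    fun v w => by ring⟩

/-- The length-rigidity matroid on `K(V)`: the algebraic dependence matroid, over `ℚ`, of the
squared lengths. A set of edges is independent iff it is contained in `K(V)` and the family of
squared lengths that it indexes is algebraically independent over `ℚ`. -/
def lengthRigidityMatroid (V : Type*) : Matroid (Sym2 V) :=
  (AlgebraicIndependent.matroid ℚ (MvPolynomial (V × Fin 2) ℚ)).comapOn
    (completeEdges V) (sqLength V)

/-- The field of rational functions in the variables `x_v, y_v` over `F`. -/
abbrev RatFun (F : Type*) [Field F] (V : Type*) : Type _ :=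
  FractionRing (MvPolynomial (V × Fin 2) F)

/-- The variable `x_v` (for `i = 0`) or `y_v` (for `i = 1`) as a rational function. -/
def ratVar (F : Type*) [Field F] {V : Type*} (v : V) (i : Fin 2) : RatFun F V :=
  algebraMap (MvPolynomial (V × Fin 2) F) (RatFun F V) (MvPolynomial.X (v, i))

/-- The slope `(y_w - y_v) / (x_w - x_v)` of the edge `vw`, a rational function over `F`. -/
def ratSlope (F : Type*) [Field F] (V : Type*) : Sym2 V → RatFun F V :=
  Sym2.lift ⟨fun v w => (ratVar F w 1 - ratVar F v 1) / (ratVar F w 0 - ratVar F v 0),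
    fun v w => by
      beta_reduce
      rw [← neg_sub (ratVar F v 1), ← neg_sub (ratVar F v 0), neg_div_neg_eq]⟩

/-- The slope-rigidity matroid on `K(V)` with coefficient field `F`: the algebraic dependence
matroid, over `F`, of the rational functions `m_{vw} = (y_w - y_v) / (x_w - x_v)`. -/
def slopeRigidityMatroid (F : Type*) [Field F] (V : Type*) : Matroid (Sym2 V) :=
  (AlgebraicIndependent.matroid F (RatFun F V)).comapOn (completeEdges V) (ratSlope F V)

variable (k : Type*) [Field k]

/-- The projective plane over `k`, with homogeneous coordinates `[a₀ : a₁ : a₂]`. The dual plane is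
represented by the same type: `[l₀ : l₁ : l₂]` stands for the line
`l₀ a₀ + l₁ a₁ + l₂ a₂ = 0`, so incidence is `Projectivization.orthogonal`. -/
abbrev Plane : Type _ := ℙ k (Fin 3 → k)

/-- A polynomial in the homogeneous coordinates of a product of projective planes indexed by `ι` is
multihomogeneous of multidegree `d` if, for every `i`, each of its monomials has total degree `d i`
in the three coordinates of the `i`-th factor. -/
def IsMultihomogeneous {ι : Type*} [DecidableEq ι] (p : MvPolynomial (ι × Fin 3) k)
    (d : ι → ℕ) : Prop :=
  MvPolynomial.IsWeightedHomogeneous (fun ij : ι × Fin 3 => (Pi.single ij.1 1 : ι → ℕ)) p d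

/-- Vanishing of a polynomial at a point of a product of projective planes. For multihomogeneous
polynomials, the only ones it is used for, it does not depend on the representatives. -/
def VanishesAt {ι : Type*} (p : MvPolynomial (ι × Fin 3) k) (P : ι → Plane k) : Prop :=
  MvPolynomial.eval (fun ij : ι × Fin 3 => (P ij.1).rep ij.2) p = 0

open Classical in
/-- The Zariski closure of a subset `S` of a product of projective planes: the common zeros of all
the multihomogeneous polynomials that vanish on `S`. -/
def zariskiClosure {ι : Type*} (S : Set (ι → Plane k)) : Set (ι → Plane k) :=
  {P | ∀ (p : MvPolynomial (ι × Fin 3) k) (d : ι → ℕ), IsMultihomogeneous k p d →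
    (∀ Q ∈ S, VanishesAt k p Q) → VanishesAt k p P}

variable {V : Type*} (G : SimpleGraph V)

/-- The product `Gr(G)` of one projective plane per vertex and one dual projective plane per
edge. -/
abbrev Gr : Type _ := V ⊕ G.edgeSet → Plane k

/-- The picture space: all `P` in `Gr(G)` such that the point `P(v)` lies on the line `P(e)` whenever
`v` is an endpoint of `e`. -/
def pictureSpace : Set (Gr k G) :=
  {P | ∀ (v : V) (e : G.edgeSet), v ∈ (e : Sym2 V) →
    Projectivization.orthogonal (P (Sum.inl v)) (P (Sum.inr e))}

/-- The discrete cellule: the pictures in which no two of the points `P(v)` coincide. -/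
def discreteCellule : Set (Gr k G) :=
  {P | P ∈ pictureSpace k G ∧ Function.Injective fun v : V => P (Sum.inl v)}

/-- The picture variety: the Zariski closure of the discrete cellule. -/
def pictureVariety : Set (Gr k G) :=
  zariskiClosure k (discreteCellule k G)

/-- The affine picture space: the pictures such that every point `P(v)` lies in the affine plane
`a₀ ≠ 0`, with affine coordinates `x = a₁ / a₀`, `y = a₂ / a₀`, and every line `P(e)` meets it in a
line that is not parallel to the `y`-axis (that is, `l₂ ≠ 0`). -/
def affinePictureSpace : Set (Gr k G) :=
  {P | P ∈ pictureSpace k G ∧ (∀ v : V, (P (Sum.inl v)).rep 0 ≠ 0) ∧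
    ∀ e : G.edgeSet, (P (Sum.inr e)).rep 2 ≠ 0}

/-- The affine picture variety. -/
def affinePictureVariety : Set (Gr k G) :=
  pictureVariety k G ∩ affinePictureSpace k G

/-- The slope `- l₁ / l₂` of the line `l₀ + l₁ x + l₂ y = 0`, where `l₂ ≠ 0`. -/
def lineSlope (l : Plane k) : k :=
  -(l.rep 1) / l.rep 2

/-- The affine slope variety: the projection of the affine picture variety on the slope coordinates
`m_e`, a subset of affine space with one coordinate per edge. -/
def affineSlopeVariety : Set (G.edgeSet → k) :=
  (fun (P : Gr k G) (e : G.edgeSet) => lineSlope k (P (Sum.inr e))) '' affinePictureVariety k G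

end

end GraphVariety

/-!
All four conditions are equivalent to Laman's condition (`IsLamanSparse`): any `n ≥ 2` vertices span
at most `2 n - 3` edges.

*Slopes and Laman's condition.* Slopes are invariant under translations and scalings, so the slopes
of the edges within a set of `n` vertices lie in a field generated by `2 n - 3` elements, and
independence forces Laman's condition (`isLamanSparse_of_algebraicIndependent_ratSlope`).

*Laman's condition and the picture variety.* In homogeneous coordinates the picture space is cut out
of a space of dimension `3 |V| + 3 |E|` by `2 |E|` equations, so by Krull's height theorem the
coordinates of the generic picture of each component generate a field of transcendence degree at
least `3 |V| + |E|` (`natCard_le_card_add_of_mem_minimalPrimes`). On the other hand, if the points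
of that picture take only `n` distinct values and `c` edges have coinciding ends, then
`2 n + c + |V| + |E|` parameters suffice (`exists_parameters`). Under Laman's condition this is
too few unless all points are distinct (`IsLamanSparse.injective_of_le`). Hence the pictures with
distinct points are dense in every component, by the Nullstellensatz
(`IsLamanSparse.pictureVariety_eq`).

*Back to slopes.* If the picture variety is the whole picture space, it contains the pictures whose
points all coincide, and the slopes of their lines are arbitrary (`affineSlopeVariety_eq_univ`).
If all slopes occur, then a relation between the generic slopes, made multihomogeneous, vanishes on
the picture variety, hence at all slope vectors, and is trivial
(`algebraicIndependent_ratSlope_of_affineSlopeVariety_eq_univ`). Passing to an algebraic closure,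
this closes the circle over every coefficient field.

*Lengths.* Over `ℚ`, algebraic independence is linear independence of differentials
(`algebraicIndependent_iff_linearIndependent_D`), and the rotation `dx ↦ dy`, `dy ↦ -dx` takes the
differential of a squared length to a nonzero multiple of the differential of the slope
(`algebraicIndependent_ratSqLength_iff`). So independence of lengths is independence of slopes
over `ℚ`, which is again Laman's condition.
-/

open scoped LinearAlgebra.Projectivization

namespace GraphVariety

/-! ### Transcendence degree and generating sets -/

theorem isAlgebraic_algebraAdjoin {k K : Type*} [Field k] [Field K] [Algebra k K] {s : Set K}
    (hs : IntermediateField.adjoin k s = ⊤) : Algebra.IsAlgebraic (Algebra.adjoin k s) K := by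
  rw [← IntermediateField.isAlgebraic_adjoin_iff_top, hs, Algebra.isAlgebraic_iff_isIntegral]
  exact Algebra.isIntegral_of_surjective IntermediateField.topEquiv.surjective

/-- A family generates, as elements of the field it generates, the whole of that field. -/
theorem adjoin_range_codRestrict {k K ι : Type*} [Field k] [Field K] [Algebra k K] (f : ι → K)
    (hf : ∀ i, f i ∈ IntermediateField.adjoin k (Set.range f)) :
    IntermediateField.adjoin k (Set.range fun i =>
      (⟨f i, hf i⟩ : IntermediateField.adjoin k (Set.range f))) = ⊤ := by
  apply IntermediateField.lift_injective
  rw [IntermediateField.lift_adjoin, IntermediateField.lift_top, ← Set.range_comp]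
  rfl

/-- Algebraically independent elements of a field generated by `Nat.card κ` elements number at most
`Nat.card κ`. -/
theorem natCard_le_of_algebraicIndependent {k K ι κ : Type*} [Field k] [Field K] [Algebra k K]
    [Finite κ] (g : κ → K) {f : ι → K} (hf : AlgebraicIndependent k f)
    (hfg : ∀ i, f i ∈ IntermediateField.adjoin k (Set.range g)) :
    Nat.card ι ≤ Nat.card κ := by
  have hg : ∀ j, g j ∈ IntermediateField.adjoin k (Set.range g) := fun j =>
    IntermediateField.subset_adjoin _ _ (Set.mem_range_self j)
  have := isAlgebraic_algebraAdjoin (adjoin_range_codRestrict g hg)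
  have hle := Algebra.IsAlgebraic.trdeg_le_cardinalMk k
    (Set.range fun j => (⟨g j, hg j⟩ : IntermediateField.adjoin k (Set.range g)))
  have hf' : AlgebraicIndependent k
      (fun i => (⟨f i, hfg i⟩ : IntermediateField.adjoin k (Set.range g))) :=
    AlgebraicIndependent.of_comp (IntermediateField.val _) hf
  have h1 := hf'.lift_cardinalMk_le_trdeg
  have h2 := Cardinal.lift_le.2 hle
  have h3 := (Cardinal.toNat_le_toNat (h1.trans h2) (by simp))
  simp only [Cardinal.toNat_lift] at h3
  exact h3.trans (Nat.card_le_card_of_surjective _ Set.rangeFactorization_surjective)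

/-! ### The Jacobian criterion in characteristic zero -/

/-- In characteristic zero a field is formally étale over the polynomial ring on a transcendence
basis, so the differentials of a transcendence basis form a basis of the Kähler differentials. -/
theorem exists_basis_kaehlerDifferential {k K : Type*} [Field k] [CharZero k] [Field K]
    [Algebra k K] {ι : Type*} {x : ι → K} (hx : IsTranscendenceBasis k x) :
    ∃ b : Module.Basis ι K Ω[K⁄k], ∀ i, b i = KaehlerDifferential.D k K (x i) := by
  let A := MvPolynomial ι k
  let : Algebra A K := (MvPolynomial.aeval x).toAlgebra
  have hA : ∀ p : A, algebraMap A K p = MvPolynomial.aeval x p := fun _ => rfl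
  have : IsScalarTower k A K := .of_algebraMap_eq fun r => by
    rw [hA]; exact (MvPolynomial.aeval_C x r).symm
  have : FaithfulSMul A K := (faithfulSMul_iff_algebraMap_injective A K).2 hx.1
  let L := FractionRing A
  let : Algebra L K := FractionRing.liftAlgebra A K
  have : IsScalarTower A L K := FractionRing.isScalarTower_liftAlgebra A K
  have : Algebra.IsAlgebraic A K := hx.isAlgebraic_iff.2 fun i => by
    have := isAlgebraic_algebraMap (R := A) (A := K) (MvPolynomial.X i)
    rwa [hA, MvPolynomial.aeval_X] at this
  have : Algebra.IsAlgebraic L K := IsFractionRing.comap_isAlgebraic_iff.1 this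
  have : CharZero L := charZero_of_injective_algebraMap (IsFractionRing.injective A L)
  have : Algebra.FormallyEtale L K := .of_isSeparable L K
  have : Algebra.FormallyEtale A L := .of_isLocalization (nonZeroDivisors A)
  have : Algebra.FormallyEtale A K := .comp A L K
  refine ⟨((KaehlerDifferential.mvPolynomialBasis k ι).baseChange K).map
    (KaehlerDifferential.tensorKaehlerEquivOfFormallyEtale k A K), fun i => ?_⟩
  rw [Module.Basis.map_apply, Module.Basis.baseChange_apply,
    KaehlerDifferential.mvPolynomialBasis_apply,
    ← KaehlerDifferential.tensorKaehlerEquivOfFormallyEtale_symm_D_algebraMap k A K,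
    LinearEquiv.apply_symm_apply, hA, MvPolynomial.aeval_X]

/-- **Jacobian criterion** in characteristic zero. -/
theorem algebraicIndependent_iff_linearIndependent_D {k K : Type*} [Field k] [CharZero k] [Field K]
    [Algebra k K] {ι : Type*} {f : ι → K} :
    AlgebraicIndependent k f ↔ LinearIndependent K fun i => KaehlerDifferential.D k K (f i) := by
  constructor
  · intro hf
    obtain ⟨t, hst, ht⟩ := exists_isTranscendenceBasis_superset
      (AlgebraicIndependent.to_subtype_range hf)
    obtain ⟨b, hb⟩ := exists_basis_kaehlerDifferential ht
    have h := b.linearIndependent.comp (fun i => ⟨f i, hst ⟨i, rfl⟩⟩ : ι → t)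
      (fun i j hij => hf.injective (congrArg Subtype.val hij))
    convert h using 2 with i
    simp [hb]
  · intro hf
    let L := IntermediateField.adjoin k (Set.range f)
    let g : ι → L := fun i => ⟨f i, IntermediateField.subset_adjoin _ _ (Set.mem_range_self i)⟩
    have : Algebra.IsAlgebraic (Algebra.adjoin k (Set.range g)) L :=
      isAlgebraic_algebraAdjoin (adjoin_range_codRestrict f _)
    obtain ⟨t, hts, ht⟩ := exists_isTranscendenceBasis_subset (R := k) (Set.range g)
    obtain ⟨b, hb⟩ := exists_basis_kaehlerDifferential ht
    -- the differentials of `f` lie in the span of those of the transcendence basis `t`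
    have hspan : ∀ i, KaehlerDifferential.D k K (f i) ∈ Submodule.span K
        ((fun i => KaehlerDifferential.D k K (f i)) '' (g ⁻¹' t)) := by
      intro i
      have h1 := b.mem_span (KaehlerDifferential.D k L (g i))
      have h2 : KaehlerDifferential.D k K (f i) =
          KaehlerDifferential.map k k L K (KaehlerDifferential.D k L (g i)) := by
        rw [KaehlerDifferential.map_D]; rfl
      rw [h2]
      refine Submodule.span_induction (p := fun y _ => KaehlerDifferential.map k k L K y ∈
        Submodule.span K ((fun i => KaehlerDifferential.D k K (f i)) '' (g ⁻¹' t)))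
        ?_ ?_ ?_ ?_ h1
      · rintro _ ⟨⟨y, hy⟩, rfl⟩
        obtain ⟨j, rfl⟩ := hts hy
        refine Submodule.subset_span ⟨j, hy, ?_⟩
        rw [hb, KaehlerDifferential.map_D]
        rfl
      · simp
      · intro x y _ _ hx hy
        rw [map_add]
        exact add_mem hx hy
      · intro a x _ hx
        rw [map_smul, ← algebraMap_smul K a]
        exact Submodule.smul_mem _ _ hx
    have hmem : ∀ i, g i ∈ t := fun i => by
      by_contra hi
      exact hf.notMem_span_image hi (hspan i)
    have hfinj : Function.Injective f := fun i j hij =>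
      hf.injective (congrArg (KaehlerDifferential.D k K) hij)
    have := ht.1.comp (fun i => ⟨g i, hmem i⟩ : ι → t)
      (fun i j hij => hfinj (congrArg (fun y : t => ((y : L) : K)) hij))
    exact this.map' (f := L.val) L.val.injective

/-! ### Length-rigidity and slope-rigidity over the rationals -/

theorem edgeSet_subset_completeEdges {V : Type*} (G : SimpleGraph V) :
    G.edgeSet ⊆ completeEdges V := fun _ he => G.not_isDiag_of_mem_edgeSet he

/-- Independence in a pulled back algebraic matroid is algebraic independence of the family. -/
theorem comapOn_matroid_indep_iff {R A α : Type*} [CommRing R] [Nontrivial R] [CommRing A]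
    [IsDomain A] [Algebra R A] [FaithfulSMul R A] {E I : Set α} (hI : I ⊆ E) (f : α → A) :
    ((AlgebraicIndependent.matroid R A).comapOn E f).Indep I ↔
      AlgebraicIndependent R fun e : I => f e := by
  rw [Matroid.comapOn_indep_iff, AlgebraicIndependent.matroid_indep_iff]
  constructor
  · rintro ⟨h, hinj, -⟩
    exact (algebraicIndependent_image hinj).2 h
  · intro h
    have hinj : Set.InjOn f I := Set.injOn_iff_injective.2 h.injective
    exact ⟨(algebraicIndependent_image hinj).1 h, hinj, hI⟩

theorem slopeRigidityMatroid_indep_edgeSet_iff (F : Type*) [Field F] {V : Type*}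
    (G : SimpleGraph V) :
    (slopeRigidityMatroid F V).Indep G.edgeSet ↔
      AlgebraicIndependent F fun e : G.edgeSet => ratSlope F V e :=
  comapOn_matroid_indep_iff (edgeSet_subset_completeEdges G) _

theorem isTranscendenceBasis_ratVar (F : Type*) [Field F] (V : Type*) :
    IsTranscendenceBasis F fun p : V × Fin 2 => ratVar F p.1 p.2 :=
  have := IsLocalization.isAlgebraic (RatFun F V) (nonZeroDivisors (MvPolynomial (V × Fin 2) F))
  (IsTranscendenceBasis.mvPolynomial (V × Fin 2) F).algebraMap_comp (A := RatFun F V)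

theorem ratVar_sub_ne_zero (F : Type*) [Field F] {V : Type*} {v w : V} (h : v ≠ w) (i : Fin 2) :
    ratVar F v i - ratVar F w i ≠ 0 := by
  rw [sub_ne_zero]
  intro h'
  have := (isTranscendenceBasis_ratVar F V).1.injective (a₁ := (v, i)) (a₂ := (w, i)) h'
  exact h (congrArg Prod.fst this)

/-- The squared length of an edge as a rational function over `F`. -/
noncomputable def ratSqLength (F : Type*) [Field F] (V : Type*) : Sym2 V → RatFun F V :=
  Sym2.lift ⟨fun v w => (ratVar F v 0 - ratVar F w 0) ^ 2 + (ratVar F v 1 - ratVar F w 1) ^ 2,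
    fun v w => by ring⟩

/-- The computation behind the comparison: a linear map with `dx ↦ dy`, `dy ↦ -dx` sends the
differential of a squared length to a multiple of the differential of a slope. -/
theorem rotation_derivation_sqLength {F K M : Type*} [Field F] [Field K] [Algebra F K]
    [AddCommGroup M] [Module K M] [Module F M] {d : Derivation F K M} {T : M →ₗ[K] M}
    {x y x' y' : K} (hx : x' - x ≠ 0) (h0 : T (d x) = d y) (h0' : T (d x') = d y')
    (h1 : T (d y) = -d x) (h1' : T (d y') = -d x') :
    T (d ((x - x') ^ 2 + (y - y') ^ 2)) =
      (2 * (x' - x) ^ 2) • d ((y' - y) / (x' - x)) := by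
  have h : 2 * (x' - x) ^ 2 * (x' - x)⁻¹ ^ 2 = 2 := by field_simp
  rw [Derivation.leibniz_div, smul_smul, h]
  simp only [map_add, Derivation.leibniz_pow, map_sub, map_smul, h0, h0', h1, h1',
    Nat.add_one_sub_one, pow_one, ← Nat.cast_smul_eq_nsmul K]
  module

/-- The linear automorphism `dx_v ↦ dy_v`, `dy_v ↦ -dx_v` of the differentials of the rational
function field carries the differentials of the squared lengths to nonzero multiples of those of
the slopes, so the two families have the same linear dependences. -/
theorem algebraicIndependent_ratSqLength_iff {F : Type*} [Field F] [CharZero F] {V : Type*}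
    (G : SimpleGraph V) :
    (AlgebraicIndependent F fun e : G.edgeSet => ratSqLength F V e) ↔
      AlgebraicIndependent F fun e : G.edgeSet => ratSlope F V e := by
  rw [algebraicIndependent_iff_linearIndependent_D, algebraicIndependent_iff_linearIndependent_D]
  obtain ⟨b, hb⟩ := exists_basis_kaehlerDifferential (isTranscendenceBasis_ratVar F V)
  let d := KaehlerDifferential.D F (RatFun F V)
  let T : Ω[RatFun F V⁄F] →ₗ[RatFun F V] Ω[RatFun F V⁄F] := b.constr (RatFun F V) fun p =>
    if p.2 = 0 then d (ratVar F p.1 1) else - d (ratVar F p.1 0)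
  have hT0 : ∀ v : V, T (d (ratVar F v 0)) = d (ratVar F v 1) := fun v => by
    have := b.constr_basis (RatFun F V) (fun p => if p.2 = 0 then d (ratVar F p.1 1)
      else - d (ratVar F p.1 0)) (v, 0)
    rw [hb] at this
    simpa using this
  have hT1 : ∀ v : V, T (d (ratVar F v 1)) = - d (ratVar F v 0) := fun v => by
    have := b.constr_basis (RatFun F V) (fun p => if p.2 = 0 then d (ratVar F p.1 1)
      else - d (ratVar F p.1 0)) (v, 1)
    rw [hb] at this
    simpa using this
  have hTT : T ∘ₗ T = -LinearMap.id := b.ext fun ⟨v, i⟩ => by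
    rw [hb]
    change T (T (d _)) = - d _
    fin_cases i
    · simp [hT0, hT1]
    · simp [hT0, hT1]
  have hker : LinearMap.ker T = ⊥ := LinearMap.ker_eq_bot'.2 fun x hx => by
    have := congrArg (fun f => f x) hTT
    simpa [hx] using this
  have : CharZero (RatFun F V) := charZero_of_injective_algebraMap (algebraMap F _).injective
  have key : ∀ e : G.edgeSet, ∃ c : (RatFun F V)ˣ,
      T (d (ratSqLength F V e)) = c • d (ratSlope F V e) := by
    rintro ⟨e, he⟩
    induction e with
    | h v w =>
      have hx : ratVar F w 0 - ratVar F v 0 ≠ 0 := ratVar_sub_ne_zero F (G.ne_of_adj he).symm 0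
      refine ⟨Units.mk0 (2 * (ratVar F w 0 - ratVar F v 0) ^ 2)
        (mul_ne_zero two_ne_zero (pow_ne_zero 2 hx)), ?_⟩
      have h1 : ratSqLength F V s(v, w) = (ratVar F v 0 - ratVar F w 0) ^ 2 +
          (ratVar F v 1 - ratVar F w 1) ^ 2 := rfl
      have h2 : ratSlope F V s(v, w) =
          (ratVar F w 1 - ratVar F v 1) / (ratVar F w 0 - ratVar F v 0) := rfl
      rw [h1, h2]
      exact rotation_derivation_sqLength hx (hT0 v) (hT0 w) (hT1 v) (hT1 w)
  choose c hc using key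
  rw [← LinearMap.linearIndependent_iff T hker]
  have h := LinearIndependent.units_smul_iff (fun e : G.edgeSet => d (ratSlope F V e)) c
  rw [← h]
  have hfun : (T ∘ fun e : G.edgeSet => d (ratSqLength F V e)) =
      c • fun e : G.edgeSet => d (ratSlope F V e) := funext hc
  exact Eq.to_iff (congrArg (fun v => LinearIndependent (RatFun F V) v) hfun)

theorem algebraicIndependent_algebraMap_iff {F : Type*} [Field F] {V ι : Type*}
    (f : ι → MvPolynomial (V × Fin 2) F) :
    AlgebraicIndependent F f ↔
      AlgebraicIndependent F fun i => algebraMap _ (RatFun F V) (f i) :=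
  ((IsScalarTower.toAlgHom F (MvPolynomial (V × Fin 2) F) (RatFun F V)).algebraicIndependent_iff
    (IsFractionRing.injective (MvPolynomial (V × Fin 2) F) (RatFun F V))).symm

theorem lengthRigidityMatroid_indep_edgeSet_iff {V : Type*} (G : SimpleGraph V) :
    (lengthRigidityMatroid V).Indep G.edgeSet ↔ (slopeRigidityMatroid ℚ V).Indep G.edgeSet := by
  rw [slopeRigidityMatroid_indep_edgeSet_iff, lengthRigidityMatroid,
    comapOn_matroid_indep_iff (edgeSet_subset_completeEdges G),
    ← algebraicIndependent_ratSqLength_iff, algebraicIndependent_algebraMap_iff]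
  have h : ∀ e : Sym2 V, algebraMap _ (RatFun ℚ V) (sqLength V e) = ratSqLength ℚ V e := by
    intro e
    induction e with
    | h v w => simp [sqLength, ratSqLength, ratVar]
  simp only [h]

/-! ### Laman's sparsity condition -/

/-- The edges of `G` both of whose ends lie in `B`. -/
def edgesIn {V : Type*} (G : SimpleGraph V) (B : Set V) : Set (Sym2 V) :=
  {e | e ∈ G.edgeSet ∧ ∀ v ∈ e, v ∈ B}

/-- Laman's condition: any `n ≥ 2` vertices span at most `2 n - 3` edges. -/
def IsLamanSparse {V : Type*} (G : SimpleGraph V) : Prop :=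
  ∀ B : Set V, B.Nontrivial → (edgesIn G B).ncard + 3 ≤ 2 * B.ncard

/-- Slopes are invariant under translation and scaling, so those of the edges within `B` lie in a
field generated by `2 |B| - 3` elements. -/
theorem isLamanSparse_of_algebraicIndependent_ratSlope {F : Type*} [Field F] {V : Type*} [Finite V]
    {G : SimpleGraph V} (h : AlgebraicIndependent F fun e : G.edgeSet => ratSlope F V e) :
    IsLamanSparse G := by
  rintro B ⟨a, ha, b, hb, hab⟩
  let s : RatFun F V := ratVar F b 0 - ratVar F a 0
  have hs : s ≠ 0 := ratVar_sub_ne_zero F hab.symm 0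
  let g : ↥(B \ {a}) ⊕ ↥((B \ {a}) \ {b}) → RatFun F V :=
    Sum.elim (fun v => (ratVar F v.1 1 - ratVar F a 1) / s)
      (fun v => (ratVar F v.1 0 - ratVar F a 0) / s)
  have hgen : ∀ j, g j ∈ IntermediateField.adjoin F (Set.range g) := fun j =>
    IntermediateField.subset_adjoin _ _ (Set.mem_range_self j)
  have hy : ∀ v ∈ B, (ratVar F v 1 - ratVar F a 1) / s ∈
      IntermediateField.adjoin F (Set.range g) := by
    intro v hv
    by_cases hva : v = a
    · simp [hva]
    · exact hgen (Sum.inl ⟨v, hv, hva⟩)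
  have hx : ∀ v ∈ B, (ratVar F v 0 - ratVar F a 0) / s ∈
      IntermediateField.adjoin F (Set.range g) := by
    intro v hv
    by_cases hva : v = a
    · simp [hva]
    by_cases hvb : v = b
    · rw [hvb, div_self hs]
      exact one_mem _
    · exact hgen (Sum.inr ⟨v, ⟨hv, hva⟩, hvb⟩)
  have hslope : ∀ e : edgesIn G B, ratSlope F V e ∈ IntermediateField.adjoin F (Set.range g) := by
    rintro ⟨e, -, he⟩
    induction e with
    | h v w =>
      have hv : v ∈ B := he v (Sym2.mem_mk_left v w)
      have hw : w ∈ B := he w (Sym2.mem_mk_right v w)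
      have heq : ratSlope F V s(v, w) =
          ((ratVar F w 1 - ratVar F a 1) / s - (ratVar F v 1 - ratVar F a 1) / s) /
          ((ratVar F w 0 - ratVar F a 0) / s - (ratVar F v 0 - ratVar F a 0) / s) := by
        rw [← sub_div, ← sub_div, div_div_div_cancel_right₀ hs, sub_sub_sub_cancel_right,
          sub_sub_sub_cancel_right]
        rfl
      change ratSlope F V s(v, w) ∈ _
      rw [heq]
      exact div_mem (sub_mem (hy w hw) (hy v hv)) (sub_mem (hx w hw) (hx v hv))
  have hind : AlgebraicIndependent F fun e : edgesIn G B => ratSlope F V e :=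
    h.comp (fun e : edgesIn G B => (⟨e.1, e.2.1⟩ : G.edgeSet))
      fun e e' hee => Subtype.ext (congrArg (fun x : G.edgeSet => (x : Sym2 V)) hee)
  have hcard := natCard_le_of_algebraicIndependent g hind hslope
  rw [Nat.card_sum, Nat.card_coe_set_eq, Nat.card_coe_set_eq, Nat.card_coe_set_eq] at hcard
  have h1 := Set.ncard_sdiff_singleton_add_one ha
  have h2 := Set.ncard_sdiff_singleton_add_one (s := B \ {a}) (a := b) ⟨hb, hab.symm⟩
  omega

/-! ### Dimension theory of polynomial rings over a field -/

theorem height_eq_natCard_of_isMaximal {K ι : Type*} [Field K] [Finite ι]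
    (M : Ideal (MvPolynomial ι K)) [hM : M.IsMaximal] : M.height = Nat.card ι := by
  induction ι using Finite.induction_empty_option with
  | @of_equiv α β e ih =>
    let f := (MvPolynomial.renameEquiv K e).toRingEquiv
    have : (M.comap f).IsMaximal := Ideal.comap_isMaximal_of_equiv f
    rw [← Nat.card_congr e, ← ih (M.comap f), RingEquiv.height_comap]
  | h_empty =>
    let f := (MvPolynomial.isEmptyAlgEquiv K PEmpty).toRingEquiv
    have := Ideal.comap_isMaximal_of_equiv f.symm (p := M)
    have h : M.comap f.symm = ⊥ := (Ideal.eq_bot_or_top _).resolve_right this.ne_top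
    rw [← RingEquiv.height_comap f.symm, h]
    simp
  | @h_option α _ ih =>
    let f := (MvPolynomial.optionEquivLeft K α).toRingEquiv
    have hmax : (M.comap f.symm).IsMaximal := Ideal.comap_isMaximal_of_equiv f.symm
    have hmax' : ((M.comap f.symm).under (MvPolynomial α K)).IsMaximal :=
      Polynomial.isMaximal_comap_C_of_isJacobsonRing _
    have : (M.comap f.symm).LiesOver ((M.comap f.symm).under (MvPolynomial α K)) := ⟨rfl⟩
    rw [← RingEquiv.height_comap f.symm, Polynomial.height_eq_height_add_one
      ((M.comap f.symm).under (MvPolynomial α K)), ih]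
    simp

/-- If the variables in `s` form a transcendence basis of an extension `K` in which the polynomial
ring maps with kernel `p`, then inverting the nonzero polynomials in these variables turns `p` into
a maximal ideal in the remaining variables, without changing its height. -/
theorem height_ker_aeval_eq_natCard_compl {k K ι : Type*} [Field k] [Field K] [Algebra k K]
    [Finite ι] (x : ι → K) (s : Set ι) [DecidablePred (· ∈ s)]
    (hs : IsTranscendenceBasis k fun i : s => x i) :
    (RingHom.ker (MvPolynomial.aeval x : MvPolynomial ι k →ₐ[k] K)).height = Nat.card ↥sᶜ := by
  let A := MvPolynomial s k
  let L := FractionRing A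
  let R' := MvPolynomial ↥sᶜ A
  let S' := MvPolynomial ↥sᶜ L
  let : Algebra A K := (MvPolynomial.aeval fun i : s => x i).toAlgebra
  have hA : ∀ p : A, algebraMap A K p = MvPolynomial.aeval (fun i : s => x i) p := fun _ => rfl
  have : IsScalarTower k A K := .of_algebraMap_eq fun r => by
    rw [hA]; exact (MvPolynomial.aeval_C _ r).symm
  have : FaithfulSMul A K := (faithfulSMul_iff_algebraMap_injective A K).2 hs.1
  let : Algebra L K := FractionRing.liftAlgebra A K
  have : IsScalarTower A L K := FractionRing.isScalarTower_liftAlgebra A K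
  have : Algebra.IsAlgebraic A K := hs.isAlgebraic_iff.2 fun i => by
    have := isAlgebraic_algebraMap (R := A) (A := K) (MvPolynomial.X i)
    rwa [hA, MvPolynomial.aeval_X] at this
  have : Algebra.IsAlgebraic L K := IsFractionRing.comap_isAlgebraic_iff.1 this
  let Ψ : S' →ₐ[L] K := MvPolynomial.aeval fun i : ↥sᶜ => x i
  have hmax : (RingHom.ker Ψ).IsMaximal := by
    apply Ideal.Quotient.maximal_of_isField
    exact (Ideal.quotientKerEquivRange Ψ).toMulEquiv.isField
      (Subalgebra.isField_of_algebraic Ψ.range)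
  let e : MvPolynomial ι k ≃ₐ[k] R' :=
    (MvPolynomial.renameEquiv k ((Equiv.sumComm _ _).trans (Equiv.Set.sumCompl s)).symm).trans
      (MvPolynomial.sumAlgEquiv k _ _)
  let j : R' →+* S' := MvPolynomial.map (algebraMap A L)
  have hcomap : RingHom.ker (MvPolynomial.aeval x : MvPolynomial ι k →ₐ[k] K) =
      ((RingHom.ker Ψ).comap j).comap e.toRingEquiv := by
    have hcomp : (MvPolynomial.aeval x : MvPolynomial ι k →ₐ[k] K).toRingHom =
        (Ψ.toRingHom.comp j).comp e.toRingEquiv.toRingHom := by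
      apply MvPolynomial.ringHom_ext
      · intro r
        change MvPolynomial.aeval x (MvPolynomial.C r) = Ψ (j (e (MvPolynomial.C r)))
        have he : e (MvPolynomial.C r) = MvPolynomial.C (MvPolynomial.C r) := e.commutes r
        rw [he, MvPolynomial.map_C, MvPolynomial.aeval_C, MvPolynomial.aeval_C,
          ← IsScalarTower.algebraMap_apply A L K, hA, MvPolynomial.aeval_C]
      · intro i
        change MvPolynomial.aeval x (MvPolynomial.X i) = Ψ (j (e (MvPolynomial.X i)))
        by_cases hi : i ∈ s
        · have he : e (MvPolynomial.X i) = MvPolynomial.C (MvPolynomial.X ⟨i, hi⟩) := by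
            simp [e, R', A, Equiv.Set.sumCompl_symm_apply_of_mem hi]
          rw [he, MvPolynomial.map_C, MvPolynomial.aeval_C,
            ← IsScalarTower.algebraMap_apply A L K, hA, MvPolynomial.aeval_X, MvPolynomial.aeval_X]
        · have he : e (MvPolynomial.X i) = MvPolynomial.X ⟨i, hi⟩ := by
            simp [e, R', A, Equiv.Set.sumCompl_symm_apply_of_notMem hi]
          rw [he, MvPolynomial.map_X, MvPolynomial.aeval_X, MvPolynomial.aeval_X]
    ext p
    exact Eq.to_iff (congrArg (· = 0) (DFunLike.congr_fun hcomp p))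
  rw [hcomap, RingEquiv.height_comap, ← height_eq_natCard_of_isMaximal (RingHom.ker Ψ)]
  let : Algebra R' S' := MvPolynomial.algebraMvPolynomial
  have := MvPolynomial.isLocalization (σ := ↥sᶜ) (nonZeroDivisors A) L
  exact IsLocalization.height_under ((nonZeroDivisors A).map MvPolynomial.C) (RingHom.ker Ψ)

/-- If the ideal of algebraic relations among `n` elements has height `h`, then at least `n - h` of
them are algebraically independent. -/
theorem exists_algebraicIndependent_of_ker_aeval {k K ι : Type*} [Field k] [Field K] [Algebra k K]
    [Finite ι] (x : ι → K) :
    ∃ s : Set ι, (AlgebraicIndependent k fun i : s => x i) ∧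
      (Nat.card ι : ℕ∞) ≤
        (RingHom.ker (MvPolynomial.aeval x : MvPolynomial ι k →ₐ[k] K)).height + Nat.card s := by
  classical
  have hx : ∀ i, x i ∈ IntermediateField.adjoin k (Set.range x) := fun i =>
    IntermediateField.subset_adjoin _ _ (Set.mem_range_self i)
  let y : ι → IntermediateField.adjoin k (Set.range x) := fun i => ⟨x i, hx i⟩
  have := isAlgebraic_algebraAdjoin (adjoin_range_codRestrict x hx)
  obtain ⟨t, hts, ht⟩ := exists_isTranscendenceBasis_subset (R := k) (Set.range y)
  choose r hr using fun a : t => hts a.2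
  have hrinj : Function.Injective r := fun a b hab => Subtype.ext (by rw [← hr a, ← hr b, hab])
  have hs : IsTranscendenceBasis k fun i : Set.range r => y i := by
    rw [← isTranscendenceBasis_equiv (Equiv.ofInjective r hrinj)]
    convert ht using 1
    exact funext hr
  refine ⟨Set.range r, hs.1.map' (f := IntermediateField.val _) Subtype.val_injective,
    ?_⟩
  have hker : RingHom.ker (MvPolynomial.aeval x : MvPolynomial ι k →ₐ[k] K) =
      RingHom.ker (MvPolynomial.aeval y :
        MvPolynomial ι k →ₐ[k] IntermediateField.adjoin k (Set.range x)) := by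
    ext p
    have h : MvPolynomial.aeval x p = IntermediateField.val _ (MvPolynomial.aeval y p) :=
      (MvPolynomial.comp_aeval_apply (f := y) (IntermediateField.val _) p).symm
    rw [RingHom.mem_ker, RingHom.mem_ker, h, map_eq_zero]
  rw [hker, height_ker_aeval_eq_natCard_compl y (Set.range r) hs, ← Nat.card_congr
    (Equiv.Set.sumCompl (Set.range r)), Nat.card_sum, Nat.cast_add, add_comm]

/-- **Dimension of a component.** In an irreducible component of the zero locus of `c` polynomials
in `n` variables, at least `n - c` parameters are needed to generate the function field. -/
theorem natCard_le_card_add_of_mem_minimalPrimes {k K ι κ : Type*} [Field k] [Field K]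
    [Algebra k K] [Finite ι] [Finite κ] (x : ι → K) (t : Finset (MvPolynomial ι k))
    (ht : RingHom.ker (MvPolynomial.aeval x : MvPolynomial ι k →ₐ[k] K) ∈
      (Ideal.span (t : Set (MvPolynomial ι k))).minimalPrimes)
    (g : κ → K) (hg : ∀ i, x i ∈ IntermediateField.adjoin k (Set.range g)) :
    Nat.card ι ≤ t.card + Nat.card κ := by
  obtain ⟨s, hs, hle⟩ := exists_algebraicIndependent_of_ker_aeval (k := k) x
  have h1 := Ideal.height_le_card_of_mem_minimalPrimes_span_finset ht
  have h2 : Nat.card s ≤ Nat.card κ := natCard_le_of_algebraicIndependent g hs fun i => hg i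
  have h3 : (Nat.card ι : ℕ∞) ≤ (t.card : ℕ∞) + Nat.card s := hle.trans (by gcongr)
  have h4 : Nat.card ι ≤ t.card + Nat.card s := by exact_mod_cast h3
  omega

/-! ### Counting the parameters of a picture over a field extension -/

section Parameters

variable {k K : Type*} [Field k] [Field K] [Algebra k K]

theorem exists_apply_ne_zero {v : Fin 3 → K} (hv : v ≠ 0) : ∃ i, v i ≠ 0 :=
  Function.ne_iff.1 hv

/-- A point of the projective plane is given by two parameters. -/
theorem exists_smul_eq_of_ne_zero (k : Type*) [Field k] [Algebra k K] {v : Fin 3 → K}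
    (hv : v ≠ 0) :
    ∃ (c : K) (u : Fin 3 → K) (g : Fin 2 → K), v = c • u ∧
      ∀ L : IntermediateField k K, (∀ j, g j ∈ L) → ∀ i, u i ∈ L := by
  obtain ⟨i₀, hi₀⟩ := exists_apply_ne_zero hv
  refine ⟨v i₀, (v i₀)⁻¹ • v, fun j => (v i₀)⁻¹ * v (i₀.succAbove j), ?_, fun L hL i => ?_⟩
  · rw [smul_inv_smul₀ hi₀]
  · induction i using Fin.succAboveCases i₀ with
    | x =>
      rw [Pi.smul_apply, smul_eq_mul, inv_mul_cancel₀ hi₀]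
      exact one_mem L
    | p j => exact hL j

/-- A line through a given point of the projective plane is given by one further parameter. -/
theorem exists_smul_eq_of_dotProduct_eq_zero (k : Type*) [Field k] [Algebra k K]
    {u l : Fin 3 → K} (hu : u ≠ 0) (hl : l ≠ 0) (hul : u ⬝ᵥ l = 0) :
    ∃ (d : K) (m : Fin 3 → K) (z : K), l = d • m ∧
      ∀ L : IntermediateField k K, (∀ i, u i ∈ L) → z ∈ L → ∀ i, m i ∈ L := by
  obtain ⟨i₀, hi₀⟩ := exists_apply_ne_zero hl
  let m := (l i₀)⁻¹ • l
  have hm₀ : m i₀ = 1 := inv_mul_cancel₀ hi₀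
  have hum : u i₀ + (u (i₀.succAbove 0) * m (i₀.succAbove 0) +
      u (i₀.succAbove 1) * m (i₀.succAbove 1)) = 0 := by
    have h : u ⬝ᵥ m = 0 := by rw [dotProduct_smul, hul, smul_zero]
    rwa [dotProduct, Fin.sum_univ_succAbove _ i₀, Fin.sum_univ_two, hm₀, mul_one] at h
  -- it suffices that the coordinates of `m` other than the `i₀`-th can be found from `z`
  suffices h : ∃ z, ∀ L : IntermediateField k K, (∀ i, u i ∈ L) → z ∈ L →
      m (i₀.succAbove 0) ∈ L ∧ m (i₀.succAbove 1) ∈ L by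
    obtain ⟨z, hz⟩ := h
    refine ⟨l i₀, m, z, (smul_inv_smul₀ hi₀ l).symm, fun L huL hzL i => ?_⟩
    induction i using Fin.succAboveCases i₀ with
    | x => rw [hm₀]; exact one_mem L
    | p j =>
      fin_cases j
      · exact (hz L huL hzL).1
      · exact (hz L huL hzL).2
  by_cases h0 : u (i₀.succAbove 0) = 0
  · by_cases h1 : u (i₀.succAbove 1) = 0
    · refine absurd (funext fun i => ?_) hu
      rw [h0, h1, zero_mul, zero_mul, add_zero, add_zero] at hum
      induction i using Fin.succAboveCases i₀ with
      | x => exact hum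
      | p j =>
        fin_cases j
        · exact h0
        · exact h1
    · refine ⟨m (i₀.succAbove 0), fun L huL hzL => ⟨hzL, ?_⟩⟩
      have : m (i₀.succAbove 1) =
          -(u i₀ + u (i₀.succAbove 0) * m (i₀.succAbove 0)) / u (i₀.succAbove 1) := by
        rw [eq_div_iff h1]
        linear_combination hum
      rw [this]
      exact div_mem (neg_mem (add_mem (huL _) (mul_mem (huL _) hzL))) (huL _)
  · refine ⟨m (i₀.succAbove 1), fun L huL hzL => ⟨?_, hzL⟩⟩
    have : m (i₀.succAbove 0) =
        -(u i₀ + u (i₀.succAbove 1) * m (i₀.succAbove 1)) / u (i₀.succAbove 0) := by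
      rw [eq_div_iff h0]
      linear_combination hum
    rw [this]
    exact div_mem (neg_mem (add_mem (huL _) (mul_mem (huL _) hzL))) (huL _)

/-- The line through two distinct points of the projective plane is determined by them. -/
theorem exists_smul_crossProduct_eq {u u' l : Fin 3 → K} (hl : l ≠ 0)
    (huu' : crossProduct u u' ≠ 0) (hul : u ⬝ᵥ l = 0) (hul' : u' ⬝ᵥ l = 0) :
    ∃ d : K, l = d • crossProduct u u' := by
  have h : crossProduct l (crossProduct u u') = 0 :=
    (Configuration.ofField.crossProduct_eq_zero_of_dotProduct_eq_zero (a := l)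
      (b := crossProduct u u') (c := u) (d := u') (by rwa [dotProduct_comm])
      (by rw [dotProduct_comm, dot_self_cross]) (by rwa [dotProduct_comm])
      (by rw [dotProduct_comm, dot_cross_self])).resolve_right huu'
  obtain ⟨d, hd⟩ := (Projectivization.mk_eq_mk_iff' K l _ hl huu').1
    ((Projectivization.mk_eq_mk_iff_crossProduct_eq_zero hl huu').2 h)
  exact ⟨d, hd.symm⟩

variable {V : Type*} {G : SimpleGraph V}

/-- The edges of `G` whose ends have the same image under `P`. -/
def collapsedEdges {α : Type*} (G : SimpleGraph V) (P : V → α) : Set G.edgeSet :=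
  {e | ∀ v ∈ (e : Sym2 V), ∀ w ∈ (e : Sym2 V), P v = P w}

/-- Homogeneous coordinates of a picture over an extension `K` of `k`, whose points take `n`
distinct values and which has `c` edges with coinciding ends, lie in the field generated by
`2 n + c` parameters and one scaling factor per vertex and per edge. -/
theorem exists_parameters [Finite V] {a : V → Fin 3 → K} {l : G.edgeSet → Fin 3 → K}
    (ha : ∀ v, a v ≠ 0) (hl : ∀ e, l e ≠ 0)
    (hal : ∀ (v : V) (e : G.edgeSet), v ∈ (e : Sym2 V) → a v ⬝ᵥ l e = 0) :
    ∃ g : ((V ⊕ Set.range (fun v => Projectivization.mk K (a v) (ha v)) × Fin 2) ⊕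
        (G.edgeSet ⊕ collapsedEdges G fun v => Projectivization.mk K (a v) (ha v))) → K,
      (∀ v i, a v i ∈ IntermediateField.adjoin k (Set.range g)) ∧
      ∀ e i, l e i ∈ IntermediateField.adjoin k (Set.range g) := by
  classical
  set P : V → ℙ K (Fin 3 → K) := fun v => Projectivization.mk K (a v) (ha v) with hP
  choose c₀ u g₀ hu hg₀ using fun q : Set.range P =>
    exists_smul_eq_of_ne_zero k q.1.rep_nonzero
  have hav : ∀ v, ∃ c : K, a v = c • u ⟨P v, v, rfl⟩ := by
    intro v
    obtain ⟨c, hc⟩ := Projectivization.exists_smul_eq_mk_rep K (a v) (ha v)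
    refine ⟨((c⁻¹ : Kˣ) : K) * c₀ ⟨P v, v, rfl⟩, ?_⟩
    rw [mul_smul, ← hu]
    change _ = ((c⁻¹ : Kˣ) : K) • (P v).rep
    rw [← hc]
    exact (inv_smul_smul c _).symm
  choose c hc using hav
  have hcz : ∀ v, c v ≠ 0 := fun v h => ha v (by rw [hc, h, zero_smul])
  have hul : ∀ (v : V) (e : G.edgeSet), v ∈ (e : Sym2 V) → u ⟨P v, v, rfl⟩ ⬝ᵥ l e = 0 := by
    intro v e hve
    have := hal v e hve
    rw [hc, smul_dotProduct] at this
    exact (smul_eq_zero.1 this).resolve_left (hcz v)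
  have huz : ∀ v, u ⟨P v, v, rfl⟩ ≠ 0 := fun v h => ha v (by rw [hc, h, smul_zero])
  -- every line is a multiple of one determined by the points on it and, on a collapsed edge, by
  -- one further parameter
  have hline : ∀ e : G.edgeSet, ∃ (d : K) (m : Fin 3 → K) (z : K), l e = d • m ∧
      ∀ L : IntermediateField k K, (∀ v i, u ⟨P v, v, rfl⟩ i ∈ L) →
        (e ∈ collapsedEdges G P → z ∈ L) → ∀ i, m i ∈ L := by
    intro e
    by_cases he : e ∈ collapsedEdges G P
    · have hv := Sym2.out_fst_mem (e : Sym2 V)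
      obtain ⟨d, m, z, h1, h2⟩ :=
        exists_smul_eq_of_dotProduct_eq_zero k (huz _) (hl e) (hul _ e hv)
      exact ⟨d, m, z, h1, fun L huL hz => h2 L (huL _) (hz he)⟩
    · simp only [collapsedEdges, Set.mem_ofPred_eq, not_forall] at he
      obtain ⟨v, hv, w, hw, hvw⟩ := he
      have hcross : crossProduct (u ⟨P v, v, rfl⟩) (u ⟨P w, w, rfl⟩) ≠ 0 := by
        intro h
        apply hvw
        rw [hP]
        dsimp only
        rw [Projectivization.mk_eq_mk_iff_crossProduct_eq_zero, hc v, hc w, map_smul, map_smul,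
          LinearMap.smul_apply, h, smul_zero, smul_zero]
      obtain ⟨d, hd⟩ := exists_smul_crossProduct_eq (hl e) hcross (hul v e hv) (hul w e hw)
      refine ⟨d, _, 0, hd, fun L huL _ i => ?_⟩
      have hu1 := huL v
      have hu2 := huL w
      rw [cross_apply]
      fin_cases i
      · exact sub_mem (mul_mem (hu1 _) (hu2 _)) (mul_mem (hu1 _) (hu2 _))
      · exact sub_mem (mul_mem (hu1 _) (hu2 _)) (mul_mem (hu1 _) (hu2 _))
      · exact sub_mem (mul_mem (hu1 _) (hu2 _)) (mul_mem (hu1 _) (hu2 _))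
  choose d m z hd hm using hline
  let g : ((V ⊕ Set.range P × Fin 2) ⊕ (G.edgeSet ⊕ collapsedEdges G P)) → K :=
    Sum.elim (Sum.elim c fun q => g₀ q.1 q.2) (Sum.elim d fun e => z e)
  have hgen : ∀ j, g j ∈ IntermediateField.adjoin k (Set.range g) := fun j =>
    IntermediateField.subset_adjoin _ _ (Set.mem_range_self j)
  have huL : ∀ v i, u ⟨P v, v, rfl⟩ i ∈ IntermediateField.adjoin k (Set.range g) := fun v =>
    hg₀ _ _ fun j => hgen (Sum.inl (Sum.inr (⟨P v, v, rfl⟩, j)))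
  refine ⟨g, fun v i => ?_, fun e i => ?_⟩
  · rw [hc v]
    exact mul_mem (hgen (Sum.inl (Sum.inl v))) (huL v i)
  · rw [hd e]
    exact mul_mem (hgen (Sum.inr (Sum.inl e)))
      (hm e _ huL (fun he => hgen (Sum.inr (Sum.inr ⟨e, he⟩))) i)

/-- In a graph that satisfies Laman's condition, a map that identifies some vertices loses more
than half as many vertices as it collapses edges. -/
theorem IsLamanSparse.injective_of_le [Finite V] (hG : IsLamanSparse G) {α : Type*} (P : V → α)
    (h : 2 * Nat.card V ≤ 2 * (Set.range P).ncard + (collapsedEdges G P).ncard) :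
    Function.Injective P := by
  classical
  have := Fintype.ofFinite V
  have hE : ((↑) '' collapsedEdges G P : Set (Sym2 V)) ⊆
      ⋃ q ∈ Finset.univ.image P, edgesIn G (P ⁻¹' {q}) := by
    rintro _ ⟨e, he, rfl⟩
    rw [Set.mem_iUnion₂]
    have hv := Sym2.out_fst_mem (e : Sym2 V)
    exact ⟨P (Quot.out (e : Sym2 V)).1, Finset.mem_image_of_mem _ (Finset.mem_univ _), e.2,
      fun w hw => he w hw _ hv⟩
  have hcE : (collapsedEdges G P).ncard ≤
      ∑ q ∈ Finset.univ.image P, (edgesIn G (P ⁻¹' {q})).ncard := by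
    rw [← Set.ncard_image_of_injective _ Subtype.val_injective]
    exact (Set.ncard_le_ncard hE (Set.toFinite _)).trans (Finset.set_ncard_biUnion_le _ _)
  have hcV : Nat.card V = ∑ q ∈ Finset.univ.image P, (P ⁻¹' {q}).ncard := by
    rw [Nat.card_eq_fintype_card, ← Finset.card_univ, Finset.card_eq_sum_card_image P]
    refine Finset.sum_congr rfl fun q _ => ?_
    rw [← Set.ncard_coe_finset]
    congr 1
    ext v
    simp
  have hcP : (Set.range P).ncard = ∑ q ∈ Finset.univ.image P, 1 := by
    rw [← Finset.card_eq_sum_ones, ← Set.ncard_coe_finset]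
    simp
  have hle : ∀ q ∈ Finset.univ.image P,
      (edgesIn G (P ⁻¹' {q})).ncard + 2 ≤ 2 * (P ⁻¹' {q}).ncard := by
    intro q hq
    obtain ⟨v, -, rfl⟩ := Finset.mem_image.1 hq
    by_cases hB : (P ⁻¹' {P v}).Nontrivial
    · have := hG _ hB
      omega
    · rw [Set.not_nontrivial_iff] at hB
      have h0 : edgesIn G (P ⁻¹' {P v}) = ∅ := by
        rw [Set.eq_empty_iff_forall_notMem]
        rintro e ⟨he, heB⟩
        induction e with
        | h a b =>
          exact G.ne_of_adj he (hB (heB a (Sym2.mem_mk_left a b)) (heB b (Sym2.mem_mk_right a b)))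
      have h1 : 0 < (P ⁻¹' {P v}).ncard := (Set.ncard_pos).2 ⟨v, rfl⟩
      rw [h0, Set.ncard_empty]
      omega
  by_contra hinj
  obtain ⟨v, w, hvw, hne⟩ := Function.not_injective_iff.1 hinj
  have hlt : ∑ q ∈ Finset.univ.image P, ((edgesIn G (P ⁻¹' {q})).ncard + 2) <
      ∑ q ∈ Finset.univ.image P, 2 * (P ⁻¹' {q}).ncard := by
    refine Finset.sum_lt_sum hle ⟨P v, Finset.mem_image_of_mem _ (Finset.mem_univ v), ?_⟩
    have := hG (P ⁻¹' {P v}) ⟨v, rfl, w, hvw.symm, hne⟩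
    omega
  rw [Finset.sum_add_distrib, ← Finset.mul_sum, ← hcV] at hlt
  have h2 : ∑ q ∈ Finset.univ.image P, 2 = 2 * (Set.range P).ncard := by
    simp only [hcP, Finset.mul_sum, mul_one]
  omega

end Parameters

/-! ### Multihomogeneous polynomials on a product of projective planes -/

section Multihomogeneous

variable {k : Type*} [Field k]

theorem IsMultihomogeneous.eval_smul {ι : Type*} [Fintype ι] [DecidableEq ι]
    {p : MvPolynomial (ι × Fin 3) k} {d : ι → ℕ} (hp : IsMultihomogeneous k p d) (c : ι → k)
    (x : ι × Fin 3 → k) :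
    MvPolynomial.eval (fun ij => c ij.1 * x ij) p =
      (∏ i, c i ^ d i) * MvPolynomial.eval x p := by
  rw [MvPolynomial.eval_eq', MvPolynomial.eval_eq', Finset.mul_sum]
  refine Finset.sum_congr rfl fun m hm => ?_
  have hd : ∀ i, ∑ j, m (i, j) = d i := by
    intro i
    have h := congrFun (hp (MvPolynomial.mem_support_iff.1 hm)) i
    rw [Finsupp.weight_apply, Finsupp.sum_fintype _ _ (by simp), Finset.sum_apply,
      Fintype.sum_prod_type] at h
    rw [← h, Finset.sum_eq_single i]
    · simp
    · intro b _ hb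
      simp [hb.symm]
    · simp
  have hprod : ∏ ij : ι × Fin 3, (c ij.1 * x ij) ^ m ij =
      (∏ i, c i ^ d i) * ∏ ij, x ij ^ m ij := by
    simp only [mul_pow, Finset.prod_mul_distrib]
    rw [Fintype.prod_prod_type]
    simp only [Finset.prod_pow_eq_pow_sum, hd]
  rw [hprod]
  ring

/-- The vanishing of a multihomogeneous polynomial at a point of a product of projective planes may
be tested on any homogeneous coordinates. -/
theorem IsMultihomogeneous.vanishesAt_mk_iff {ι : Type*} [Finite ι] [DecidableEq ι]
    {p : MvPolynomial (ι × Fin 3) k} {d : ι → ℕ} (hp : IsMultihomogeneous k p d)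
    (x : ι × Fin 3 → k) (hx : ∀ i, (fun j => x (i, j)) ≠ 0) :
    VanishesAt k p (fun i => Projectivization.mk k (fun j => x (i, j)) (hx i)) ↔
      MvPolynomial.eval x p = 0 := by
  have := Fintype.ofFinite ι
  choose c hc using fun i => Projectivization.exists_smul_eq_mk_rep k _ (hx i)
  have h : (fun ij : ι × Fin 3 =>
      (Projectivization.mk k (fun j => x (ij.1, j)) (hx ij.1)).rep ij.2) =
      fun ij => (c ij.1 : k) * x ij := by
    funext ij
    rw [← hc]
    rfl
  rw [VanishesAt, h, hp.eval_smul (fun i => (c i : k)) x, mul_eq_zero]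
  exact or_iff_right (Finset.prod_ne_zero_iff.2 fun i _ => pow_ne_zero _ (c i).ne_zero)

theorem mem_zariskiClosure_iff {ι : Type*} [DecidableEq ι] {S : Set (ι → Plane k)}
    {P : ι → Plane k} : P ∈ zariskiClosure k S ↔
      ∀ (p : MvPolynomial (ι × Fin 3) k) (d : ι → ℕ), IsMultihomogeneous k p d →
        (∀ Q ∈ S, VanishesAt k p Q) → VanishesAt k p P := by
  have h : (fun a b => Classical.propDecidable (a = b) : DecidableEq ι) = ‹DecidableEq ι› :=
    Subsingleton.elim _ _
  unfold zariskiClosure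
  rw [h]
  rfl

/-- The incidence polynomial `∑ a_j l_j` of the `i`-th and the `i'`-th factor. -/
noncomputable def incidence (k : Type*) [Field k] {ι : Type*} (i i' : ι) :
    MvPolynomial (ι × Fin 3) k :=
  ∑ j : Fin 3, MvPolynomial.X (i, j) * MvPolynomial.X (i', j)

theorem isMultihomogeneous_incidence {ι : Type*} [DecidableEq ι] (i i' : ι) :
    IsMultihomogeneous k (incidence k i i') (Pi.single i 1 + Pi.single i' 1) :=
  MvPolynomial.IsWeightedHomogeneous.sum _ _ _ fun j _ =>
    (MvPolynomial.isWeightedHomogeneous_X k _ (i, j)).mul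
      (MvPolynomial.isWeightedHomogeneous_X k _ (i', j))

theorem aeval_incidence {K ι : Type*} [Field K] [Algebra k K] (i i' : ι) (x : ι × Fin 3 → K) :
    MvPolynomial.aeval x (incidence k i i') =
      (fun j => x (i, j)) ⬝ᵥ (fun j => x (i', j)) := by
  simp [incidence, dotProduct]

theorem orthogonal_iff_rep {m : Type*} [Fintype m] {K : Type*} [Field K] (p q : ℙ K (m → K)) :
    Projectivization.orthogonal p q ↔ p.rep ⬝ᵥ q.rep = 0 := by
  conv_lhs => rw [← p.mk_rep, ← q.mk_rep]
  rw [Projectivization.orthogonal_mk]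

variable {V : Type*} (G : SimpleGraph V)

variable (k) in
theorem pictureVariety_subset_pictureSpace : pictureVariety k G ⊆ pictureSpace k G := by
  classical
  intro P hP v e hve
  rw [orthogonal_iff_rep]
  have h : ∀ Q : Gr k G, VanishesAt k (incidence k (Sum.inl v) (Sum.inr e)) Q ↔
      (Q (Sum.inl v)).rep ⬝ᵥ (Q (Sum.inr e)).rep = 0 := by
    intro Q
    rw [VanishesAt, ← MvPolynomial.aeval_eq_eval]
    exact Eq.to_iff (congrArg (· = 0) (aeval_incidence _ _ _))
  rw [← h]
  refine mem_zariskiClosure_iff.1 hP _ _ (isMultihomogeneous_incidence _ _) fun Q hQ => ?_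
  rw [h, ← orthogonal_iff_rep]
  exact hQ.1 v e hve

/-- The polynomial vector whose value is the cross product of the `i`-th and `i'`-th factor. -/
noncomputable def crossPolynomial (k : Type*) [Field k] {ι : Type*} (i i' : ι) :
    Fin 3 → MvPolynomial (ι × Fin 3) k :=
  crossProduct (fun j => MvPolynomial.X (i, j)) (fun j => MvPolynomial.X (i', j))

theorem aeval_crossPolynomial {K ι : Type*} [Field K] [Algebra k K] (i i' : ι)
    (x : ι × Fin 3 → K) (j : Fin 3) :
    MvPolynomial.aeval x (crossPolynomial k i i' j) =
      crossProduct (fun j => x (i, j)) (fun j => x (i', j)) j := by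
  rw [crossPolynomial, cross_apply, cross_apply]
  fin_cases j <;> simp

variable {G}

/-- The `2 |E|` incidence equations. -/
theorem exists_finset_incidence (k : Type*) [Field k] [Finite V] (G : SimpleGraph V) :
    ∃ t : Finset (MvPolynomial ((V ⊕ G.edgeSet) × Fin 3) k), t.card ≤ 2 * Nat.card G.edgeSet ∧
      ∀ p, p ∈ t ↔ ∃ (v : V) (e : G.edgeSet), v ∈ (e : Sym2 V) ∧
        incidence k (Sum.inl v) (Sum.inr e) = p := by
  classical
  have := Fintype.ofFinite G.edgeSet
  have hends : ∀ e : G.edgeSet, ∃ f : Bool → V, ∀ v, v ∈ (e : Sym2 V) ↔ ∃ b, f b = v := by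
    rintro ⟨e, he⟩
    induction e with
    | h a b =>
      exact ⟨fun c => if c then a else b, fun v => by simp [Sym2.mem_iff, eq_comm, or_comm]⟩
  choose f hf using hends
  refine ⟨Finset.univ.image fun x : G.edgeSet × Bool =>
    incidence k (Sum.inl (f x.1 x.2)) (Sum.inr x.1), ?_, fun p => ?_⟩
  · refine Finset.card_image_le.trans ?_
    rw [Finset.card_univ, Fintype.card_prod, Fintype.card_bool, Nat.card_eq_fintype_card, mul_comm]
  · simp only [Finset.mem_image, Finset.mem_univ, true_and, Prod.exists, hf]
    constructor
    · rintro ⟨e, b, rfl⟩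
      exact ⟨f e b, e, ⟨b, rfl⟩, rfl⟩
    · rintro ⟨v, e, ⟨b, rfl⟩, rfl⟩
      exact ⟨e, b, rfl⟩

/-- Laman's condition makes the points of the generic picture of every component distinct. -/
theorem IsLamanSparse.injective_of_ker_mem_minimalPrimes {K : Type*} [Field K] [Algebra k K]
    [Finite V] (hG : IsLamanSparse G) (x : (V ⊕ G.edgeSet) × Fin 3 → K)
    (hx : ∀ i, (fun j => x (i, j)) ≠ 0)
    (t : Finset (MvPolynomial ((V ⊕ G.edgeSet) × Fin 3) k))
    (htcard : t.card ≤ 2 * Nat.card G.edgeSet)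
    (ht : ∀ (v : V) (e : G.edgeSet), v ∈ (e : Sym2 V) →
      incidence k (Sum.inl v) (Sum.inr e) ∈ t)
    (hmin : RingHom.ker (MvPolynomial.aeval x : MvPolynomial _ k →ₐ[k] K) ∈
      (Ideal.span (t : Set (MvPolynomial ((V ⊕ G.edgeSet) × Fin 3) k))).minimalPrimes) :
    Function.Injective fun v : V =>
      Projectivization.mk K (fun j => x (Sum.inl v, j)) (hx (Sum.inl v)) := by
  obtain ⟨g, hga, hgl⟩ := exists_parameters (k := k) (G := G)
    (a := fun v j => x (Sum.inl v, j)) (l := fun e j => x (Sum.inr e, j))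
    (fun v => hx (Sum.inl v)) (fun e => hx (Sum.inr e)) fun v e hve => by
      rw [← aeval_incidence (k := k)]
      exact hmin.1.2 (Ideal.subset_span (ht v e hve))
  have hfin : (Set.range fun v : V =>
      Projectivization.mk K (fun j => x (Sum.inl v, j)) (hx (Sum.inl v))).Finite :=
    Set.finite_range _
  have := hfin.to_subtype
  have hcard := natCard_le_card_add_of_mem_minimalPrimes x t hmin g fun i => by
    obtain ⟨v | e, j⟩ := i
    · exact hga v j
    · exact hgl e j
  apply hG.injective_of_le
  simp only [Nat.card_sum, Nat.card_prod, Nat.card_fin, Nat.card_coe_set_eq] at hcard htcard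
  omega

/-- **Laman's condition implies that the picture variety is the picture space.** -/
theorem IsLamanSparse.pictureVariety_eq [IsAlgClosed k] [Finite V] (hG : IsLamanSparse G) :
    pictureVariety k G = pictureSpace k G := by
  classical
  refine (pictureVariety_subset_pictureSpace k G).antisymm fun P hP =>
    mem_zariskiClosure_iff.2 fun p d hp hvan => ?_
  have := Fintype.ofFinite V
  have := Fintype.ofFinite G.edgeSet
  obtain ⟨t, htcard, ht⟩ := exists_finset_incidence k G
  let x₀ : (V ⊕ G.edgeSet) × Fin 3 → k := fun ij => (P ij.1).rep ij.2
  let m := RingHom.ker (MvPolynomial.eval x₀)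
  have : m.IsPrime := RingHom.ker_isPrime _
  have htm : Ideal.span (t : Set (MvPolynomial ((V ⊕ G.edgeSet) × Fin 3) k)) ≤ m := by
    rw [Ideal.span_le]
    intro q hq
    obtain ⟨v, e, hve, rfl⟩ := (ht q).1 hq
    change MvPolynomial.aeval x₀ _ = 0
    rw [aeval_incidence]
    exact (orthogonal_iff_rep _ _).1 (hP v e hve)
  -- a component of the multicone over the picture space through the point `x₀` over `P`, and its
  -- generic point `x`, with coordinates in the function field `K`
  obtain ⟨I, hI, hIm⟩ := Ideal.exists_minimalPrimes_le htm
  have hprime : I.IsPrime := hI.1.1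
  let K := FractionRing (MvPolynomial ((V ⊕ G.edgeSet) × Fin 3) k ⧸ I)
  let x : (V ⊕ G.edgeSet) × Fin 3 → K := fun ij =>
    algebraMap _ K (Ideal.Quotient.mk I (MvPolynomial.X ij))
  have hxeval : ∀ q, MvPolynomial.aeval x q = algebraMap _ K (Ideal.Quotient.mk I q) := fun q =>
    (DFunLike.congr_fun (MvPolynomial.aeval_unique
      ((IsScalarTower.toAlgHom k _ K).comp (Ideal.Quotient.mkₐ k I))) q).symm
  have hker : RingHom.ker (MvPolynomial.aeval x : MvPolynomial _ k →ₐ[k] K) = I := by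
    ext q
    rw [RingHom.mem_ker, hxeval, map_eq_zero_iff _ (IsFractionRing.injective _ K),
      Ideal.Quotient.eq_zero_iff_mem]
  have hmem : ∀ q, q ∈ I ↔ MvPolynomial.aeval x q = 0 := fun q => by
    rw [← RingHom.mem_ker, hker]
  -- coordinates that do not vanish at `P`
  choose c hc using fun i : V ⊕ G.edgeSet => exists_apply_ne_zero (P i).rep_nonzero
  have hcI : ∀ i, MvPolynomial.X (i, c i) ∉ I := fun i hi => hc i (by
    have h := hIm hi
    rwa [RingHom.mem_ker, MvPolynomial.eval_X] at h)
  have hx : ∀ i, (fun j => x (i, j)) ≠ 0 := fun i h => hcI i (by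
    rw [hmem, MvPolynomial.aeval_X]
    exact congrFun h (c i))
  have hinj := hG.injective_of_ker_mem_minimalPrimes (k := k) x hx t htcard
    (fun v e hve => (ht _).2 ⟨v, e, hve, rfl⟩) (by rw [hker]; exact hI)
  -- polynomials that separate the points, and do not vanish on the component
  have hsep : ∀ vw : {vw : V × V // vw.1 ≠ vw.2}, ∃ j,
      crossPolynomial k (Sum.inl vw.1.1) (Sum.inl vw.1.2 : V ⊕ G.edgeSet) j ∉ I := by
    rintro ⟨⟨v, w⟩, hvw⟩
    by_contra! hall
    refine hvw (hinj ((Projectivization.mk_eq_mk_iff_crossProduct_eq_zero _ _).2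
      (funext fun j => ?_)))
    rw [← aeval_crossPolynomial (k := k)]
    exact (hmem _).1 (hall j)
  choose j hj using hsep
  let N : MvPolynomial ((V ⊕ G.edgeSet) × Fin 3) k :=
    (∏ i, MvPolynomial.X (i, c i)) *
      ∏ vw, crossPolynomial k (Sum.inl vw.1.1) (Sum.inl vw.1.2 : V ⊕ G.edgeSet) (j vw)
  have hN : N ∉ I := by
    refine fun h => (hprime.mem_or_mem h).elim (fun h => ?_) fun h => ?_
    · obtain ⟨i, -, hi⟩ := (Ideal.IsPrime.prod_mem_iff).1 h
      exact hcI i hi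
    · obtain ⟨vw, -, hvw⟩ := (Ideal.IsPrime.prod_mem_iff).1 h
      exact hj vw hvw
  -- away from the zeros of `N`, points of the component are pictures with distinct points
  have hpN : p * N ∈ I := by
    rw [← hprime.radical, ← MvPolynomial.vanishingIdeal_zeroLocus_eq_radical (K := k),
      MvPolynomial.mem_vanishingIdeal_iff]
    intro y hy
    rw [map_mul, mul_eq_zero, or_iff_not_imp_right]
    intro hNy
    rw [map_mul, mul_eq_zero, not_or, ← ne_eq, ← ne_eq, map_prod, map_prod, Finset.prod_ne_zero_iff,
      Finset.prod_ne_zero_iff] at hNy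
    have hy0 : ∀ i, (fun j => y (i, j)) ≠ 0 := fun i h => hNy.1 i (Finset.mem_univ i) (by
      rw [MvPolynomial.aeval_X]
      exact congrFun h (c i))
    have h := hvan (fun i => Projectivization.mk k (fun j => y (i, j)) (hy0 i)) ⟨?_, ?_⟩
    · rw [MvPolynomial.aeval_eq_eval]
      exact (IsMultihomogeneous.vanishesAt_mk_iff hp y hy0).1 h
    · intro v e hve
      rw [Projectivization.orthogonal_mk, ← aeval_incidence (k := k)]
      exact hy _ (hI.1.2 (Ideal.subset_span ((ht _).2 ⟨v, e, hve, rfl⟩)))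
    · intro v w hvw
      by_contra hne
      refine hNy.2 ⟨(v, w), hne⟩ (Finset.mem_univ _) ?_
      rw [aeval_crossPolynomial]
      exact congrFun ((Projectivization.mk_eq_mk_iff_crossProduct_eq_zero _ _).1 hvw) _
  exact hIm ((hprime.mem_or_mem hpN).resolve_right hN)

end Multihomogeneous

/-! ### Slopes of pictures -/

section Slopes

variable {k : Type*} [Field k] {V : Type*} {G : SimpleGraph V}

theorem exists_smul_mk_rep {v : Fin 3 → k} (hv : v ≠ 0) :
    ∃ c : k, c ≠ 0 ∧ ∀ i, (Projectivization.mk k v hv).rep i = c * v i := by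
  obtain ⟨c, hc⟩ := Projectivization.exists_smul_eq_mk_rep k v hv
  exact ⟨c, c.ne_zero, fun i => by rw [← hc]; rfl⟩

/-- A picture all of whose points coincide may have lines of arbitrary slopes. -/
theorem affineSlopeVariety_eq_univ (h : pictureVariety k G = pictureSpace k G) :
    affineSlopeVariety k G = Set.univ := by
  rw [Set.eq_univ_iff_forall]
  intro m
  have ha : (![1, 0, 0] : Fin 3 → k) ≠ 0 := fun h => one_ne_zero (congrFun h 0)
  have hl : ∀ e, (![0, -m e, 1] : Fin 3 → k) ≠ 0 := fun e h => one_ne_zero (congrFun h 2)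
  obtain ⟨c, hc, hca⟩ := exists_smul_mk_rep ha
  let P : Gr k G := Sum.elim (fun _ => Projectivization.mk k _ ha)
    fun e => Projectivization.mk k _ (hl e)
  have hP : P ∈ pictureSpace k G := fun v e _ => by
    change Projectivization.orthogonal (Projectivization.mk k _ ha) (Projectivization.mk k _ (hl e))
    rw [Projectivization.orthogonal_mk]
    simp [dotProduct, Fin.sum_univ_three]
  refine ⟨P, ⟨h ▸ hP, hP, fun v => ?_, fun e => ?_⟩, funext fun e => ?_⟩
  · change (Projectivization.mk k _ ha).rep 0 ≠ 0
    rw [hca]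
    simpa using hc
  · obtain ⟨d, hd, hdl⟩ := exists_smul_mk_rep (hl e)
    change (Projectivization.mk k _ (hl e)).rep 2 ≠ 0
    rw [hdl]
    simpa using hd
  · obtain ⟨d, hd, hdl⟩ := exists_smul_mk_rep (hl e)
    change -(Projectivization.mk k _ (hl e)).rep 1 / (Projectivization.mk k _ (hl e)).rep 2 = m e
    rw [hdl, hdl]
    simp [mul_div_cancel_left₀ _ hd]

/-- A polynomial relation between fractions persists under every homomorphism to a field that does
not kill the denominators. -/
theorem aeval_div_eq_zero_of_fractionRing {F A σ : Type*} [Field F] [CommRing A] [IsDomain A]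
    [Algebra F A] [Algebra F k] (φ : A →ₐ[F] k) (a b : σ → A) (hb : ∀ i, φ (b i) ≠ 0)
    (p : MvPolynomial σ F)
    (hp : MvPolynomial.aeval (fun i => algebraMap A (FractionRing A) (a i) /
      algebraMap A (FractionRing A) (b i)) p = 0) :
    MvPolynomial.aeval (fun i => φ (a i) / φ (b i)) p = 0 := by
  let M : Submonoid A := (nonZeroDivisors k).comap φ
  have hM : M ≤ nonZeroDivisors A := fun x hx => mem_nonZeroDivisors_of_ne_zero fun h => by
    have := nonZeroDivisors.ne_zero (show φ x ∈ nonZeroDivisors k from hx)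
    exact this (by rw [h, map_zero])
  have hbM : ∀ i, b i ∈ M := fun i => mem_nonZeroDivisors_of_ne_zero (hb i)
  have hunit : ∀ y : M, IsUnit (φ y) := fun y => (nonZeroDivisors.ne_zero y.2).isUnit
  let B := Localization M
  let toFrac : B →ₐ[F] FractionRing A := IsLocalization.liftAlgHom (M := M)
    (f := IsScalarTower.toAlgHom F A (FractionRing A)) fun y =>
      IsLocalization.map_units (FractionRing A) (⟨y, hM y.2⟩ : nonZeroDivisors A)
  let toField : B →ₐ[F] k := IsLocalization.liftAlgHom (M := M) (f := φ) hunit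
  let s : σ → B := fun i => IsLocalization.mk' B (a i) ⟨b i, hbM i⟩
  have hfrac : ∀ x, toFrac (algebraMap A B x) = algebraMap A (FractionRing A) x := fun x =>
    IsLocalization.lift_eq _ x
  have hfield : ∀ x, toField (algebraMap A B x) = φ x := fun x => IsLocalization.lift_eq _ x
  have hspec : ∀ i, s i * algebraMap A B (b i) = algebraMap A B (a i) := fun i =>
    IsLocalization.mk'_spec B (a i) ⟨b i, hbM i⟩
  have hinj : Function.Injective toFrac := by
    rw [injective_iff_map_eq_zero]
    intro z hz
    obtain ⟨x, y, rfl⟩ := IsLocalization.exists_mk'_eq M z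
    have h := congrArg toFrac (IsLocalization.mk'_spec B x y)
    rw [map_mul, hz, zero_mul, hfrac, eq_comm,
      map_eq_zero_iff _ (IsFractionRing.injective A _)] at h
    rw [h, IsLocalization.mk'_zero]
  have h1 : ∀ i, toFrac (s i) = algebraMap A (FractionRing A) (a i) /
      algebraMap A (FractionRing A) (b i) := fun i => by
    rw [eq_div_iff (IsFractionRing.to_map_ne_zero_of_mem_nonZeroDivisors (hM (hbM i))), ← hfrac,
      ← hfrac, ← map_mul, hspec]
  have h2 : ∀ i, toField (s i) = φ (a i) / φ (b i) := fun i => by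
    rw [eq_div_iff (hb i), ← hfield, ← hfield, ← map_mul, hspec]
  have hs : MvPolynomial.aeval s p = 0 := by
    apply hinj
    rw [map_zero, ← hp, ← funext h1]
    exact MvPolynomial.comp_aeval_apply (f := s) toFrac p
  rw [← funext h2, ← map_zero toField, ← hs]
  exact (MvPolynomial.comp_aeval_apply (f := s) toField p).symm

/-- A relation between the generic slopes holds for the slopes of every point configuration in which
no edge is vertical. -/
theorem aeval_slope_eq_zero {F : Type*} [Field F] [Algebra F k] (x y : V → k)
    (hx : ∀ v w, s(v, w) ∈ G.edgeSet → x v ≠ x w) (m : G.edgeSet → k)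
    (hm : ∀ (v w : V) (h : s(v, w) ∈ G.edgeSet),
      m ⟨s(v, w), h⟩ = (y w - y v) / (x w - x v))
    (p : MvPolynomial G.edgeSet F)
    (hp : MvPolynomial.aeval (fun e : G.edgeSet => ratSlope F V e) p = 0) :
    MvPolynomial.aeval m p = 0 := by
  have hends : ∀ e : G.edgeSet, ∃ v w, (e : Sym2 V) = s(v, w) := fun e => by
    induction (e : Sym2 V) with
    | h v w => exact ⟨v, w, rfl⟩
  choose f g hfg using hends
  let φ : MvPolynomial (V × Fin 2) F →ₐ[F] k :=
    MvPolynomial.aeval fun vi => if vi.2 = 0 then x vi.1 else y vi.1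
  let num : G.edgeSet → MvPolynomial (V × Fin 2) F := fun e =>
    MvPolynomial.X (g e, 1) - MvPolynomial.X (f e, 1)
  let den : G.edgeSet → MvPolynomial (V × Fin 2) F := fun e =>
    MvPolynomial.X (g e, 0) - MvPolynomial.X (f e, 0)
  have hslope : ∀ e : G.edgeSet, ratSlope F V e =
      algebraMap _ (RatFun F V) (num e) / algebraMap _ (RatFun F V) (den e) := fun e => by
    rw [hfg, map_sub, map_sub]
    rfl
  have hφ0 : ∀ v, φ (MvPolynomial.X (v, 0)) = x v := fun v => by simp [φ]
  have hφ1 : ∀ v, φ (MvPolynomial.X (v, 1)) = y v := fun v => by simp [φ]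
  have hmφ : ∀ e : G.edgeSet, m e = φ (num e) / φ (den e) := fun e => by
    rw [map_sub, map_sub, hφ0, hφ0, hφ1, hφ1, ← hm (f e) (g e) (hfg e ▸ e.2)]
    exact congrArg m (Subtype.ext (hfg e))
  rw [funext hslope] at hp
  rw [funext hmφ]
  refine aeval_div_eq_zero_of_fractionRing φ num den (fun e => ?_) p hp
  rw [map_sub, hφ0, hφ0, sub_ne_zero]
  exact (hx _ _ (hfg e ▸ e.2)).symm

/-- The slopes of the lines of an affine picture with distinct points are the slopes of the
segments between the points, and so satisfy every relation of the generic slopes. -/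
theorem aeval_lineSlope_eq_zero {F : Type*} [Field F] [Algebra F k] {Q : Gr k G}
    (hQ : Q ∈ discreteCellule k G) (hQ0 : ∀ v : V, (Q (Sum.inl v)).rep 0 ≠ 0)
    (hQ2 : ∀ e : G.edgeSet, (Q (Sum.inr e)).rep 2 ≠ 0) (p : MvPolynomial G.edgeSet F)
    (hp : MvPolynomial.aeval (fun e : G.edgeSet => ratSlope F V e) p = 0) :
    MvPolynomial.aeval (fun e => lineSlope k (Q (Sum.inr e))) p = 0 := by
  let x : V → k := fun v => (Q (Sum.inl v)).rep 1 / (Q (Sum.inl v)).rep 0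
  let y : V → k := fun v => (Q (Sum.inl v)).rep 2 / (Q (Sum.inl v)).rep 0
  have hline : ∀ (v : V) (e : G.edgeSet), v ∈ (e : Sym2 V) →
      (Q (Sum.inr e)).rep 0 + (Q (Sum.inr e)).rep 1 * x v + (Q (Sum.inr e)).rep 2 * y v = 0 := by
    intro v e hve
    have h := (orthogonal_iff_rep _ _).1 (hQ.1 v e hve)
    rw [dotProduct, Fin.sum_univ_three] at h
    have h0 := hQ0 v
    simp only [x, y]
    field_simp
    linear_combination h
  have hinj : ∀ v w, x v = x w → y v = y w → v = w := by
    intro v w hx hy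
    apply hQ.2
    dsimp only
    rw [← (Q (Sum.inl v)).mk_rep, ← (Q (Sum.inl w)).mk_rep, Projectivization.mk_eq_mk_iff']
    refine ⟨(Q (Sum.inl v)).rep 0 / (Q (Sum.inl w)).rep 0, funext fun i => ?_⟩
    have hv := hQ0 v
    have hw := hQ0 w
    simp only [x, y, div_eq_div_iff hv hw] at hx hy
    rw [Pi.smul_apply, smul_eq_mul, div_mul_eq_mul_div, div_eq_iff hw]
    fin_cases i
    · rfl
    · exact (mul_comm _ _).trans hx.symm
    · exact (mul_comm _ _).trans hy.symm
  have hxne : ∀ v w, s(v, w) ∈ G.edgeSet → x v ≠ x w := by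
    intro v w he hxy
    refine G.ne_of_adj he (hinj v w hxy (mul_left_cancel₀ (hQ2 ⟨_, he⟩) ?_))
    have hv := hline v ⟨_, he⟩ (Sym2.mem_mk_left v w)
    have hw := hline w ⟨_, he⟩ (Sym2.mem_mk_right v w)
    rw [hxy] at hv
    linear_combination hv - hw
  refine aeval_slope_eq_zero x y hxne _ (fun v w he => ?_) p hp
  have hv := hline v ⟨_, he⟩ (Sym2.mem_mk_left v w)
  have hw := hline w ⟨_, he⟩ (Sym2.mem_mk_right v w)
  rw [lineSlope, div_eq_div_iff (hQ2 _) (sub_ne_zero.2 (hxne v w he).symm)]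
  linear_combination hv - hw

/-- If all slopes occur in the picture variety, then the generic slopes satisfy no relation: a
relation, made multihomogeneous in the coordinates of the lines, would vanish on the picture
variety. -/
theorem algebraicIndependent_ratSlope_of_affineSlopeVariety_eq_univ {F : Type*} [Field F]
    [Algebra F k] [Infinite k] [Finite V] (h : affineSlopeVariety k G = Set.univ) :
    AlgebraicIndependent F fun e : G.edgeSet => ratSlope F V e := by
  classical
  have := Fintype.ofFinite V
  have := Fintype.ofFinite G.edgeSet
  rw [algebraicIndependent_iff]
  intro p hp
  -- larger than every exponent, so that `l₂` divides every term of the relation `q` below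
  let n : ℕ := p.totalDegree + 1
  let l : G.edgeSet → Fin 3 → MvPolynomial ((V ⊕ G.edgeSet) × Fin 3) k :=
    fun e j => MvPolynomial.X (Sum.inr e, j)
  -- the relation with `-l₁ / l₂` substituted for the slope, times `l₂ ^ n` for every edge; the
  -- factors `a₀` make it vanish where some point is at infinity
  let q : MvPolynomial ((V ⊕ G.edgeSet) × Fin 3) k :=
    (∏ v : V, MvPolynomial.X (Sum.inl v, 0)) *
      ∑ s ∈ p.support, MvPolynomial.C (algebraMap F k (p.coeff s)) *
        ∏ e, ((-l e 1) ^ s e * l e 2 ^ (n - s e))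
  have hle : ∀ s ∈ p.support, ∀ e, s e < n := fun s hs e =>
    Nat.lt_succ_of_le ((Finsupp.le_degree e s).trans (MvPolynomial.le_totalDegree hs))
  have hq : IsMultihomogeneous k q (∑ v : V, Pi.single (Sum.inl v) 1 +
      ∑ e : G.edgeSet, n • Pi.single (Sum.inr e) 1) := by
    refine MvPolynomial.IsWeightedHomogeneous.mul
      (MvPolynomial.IsWeightedHomogeneous.prod _ _ _ fun v _ =>
        MvPolynomial.isWeightedHomogeneous_X k _ (Sum.inl v, 0))
      (MvPolynomial.IsWeightedHomogeneous.sum _ _ _ fun s hs => ?_)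
    rw [← zero_add (∑ e : G.edgeSet, n • Pi.single (Sum.inr e) 1)]
    refine (MvPolynomial.isWeightedHomogeneous_C _ _).mul
      (MvPolynomial.IsWeightedHomogeneous.prod _ _ _ fun e _ => ?_)
    have h1 := MvPolynomial.isWeightedHomogeneous_X k
      (fun ij : (V ⊕ G.edgeSet) × Fin 3 => (Pi.single ij.1 1 : V ⊕ G.edgeSet → ℕ)) (Sum.inr e, 1)
    have h2 := MvPolynomial.isWeightedHomogeneous_X k
      (fun ij : (V ⊕ G.edgeSet) × Fin 3 => (Pi.single ij.1 1 : V ⊕ G.edgeSet → ℕ)) (Sum.inr e, 2)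
    have h1' := (MvPolynomial.weightedHomogeneousSubmodule k _ _).neg_mem h1
    have h := (MvPolynomial.IsWeightedHomogeneous.pow h1' (s e)).mul
      (MvPolynomial.IsWeightedHomogeneous.pow h2 (n - s e))
    rw [← add_smul, Nat.add_sub_cancel' (hle s hs e).le] at h
    exact h
  have hqeval : ∀ P : Gr k G, MvPolynomial.eval (fun ij => (P ij.1).rep ij.2) q =
      (∏ v : V, (P (Sum.inl v)).rep 0) * ∑ s ∈ p.support, algebraMap F k (p.coeff s) *
        ∏ e, ((-(P (Sum.inr e)).rep 1) ^ s e * (P (Sum.inr e)).rep 2 ^ (n - s e)) := by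
    intro P
    simp [q, l, map_sum, map_prod]
  have heval : ∀ P : Gr k G, (∀ v : V, (P (Sum.inl v)).rep 0 ≠ 0) →
      (∀ e : G.edgeSet, (P (Sum.inr e)).rep 2 ≠ 0) →
      (VanishesAt k q P ↔ MvPolynomial.aeval (fun e => lineSlope k (P (Sum.inr e))) p = 0) := by
    intro P hP0 hP2
    have h : ∑ s ∈ p.support, algebraMap F k (p.coeff s) *
        ∏ e, ((-(P (Sum.inr e)).rep 1) ^ s e * (P (Sum.inr e)).rep 2 ^ (n - s e)) =
        (∏ e, (P (Sum.inr e)).rep 2 ^ n) *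
          MvPolynomial.aeval (fun e => lineSlope k (P (Sum.inr e))) p := by
      rw [MvPolynomial.aeval_def, MvPolynomial.eval₂_eq', Finset.mul_sum]
      refine Finset.sum_congr rfl fun s hs => ?_
      rw [mul_left_comm, ← Finset.prod_mul_distrib]
      congr 1
      refine Finset.prod_congr rfl fun e _ => ?_
      rw [lineSlope, div_pow, ← pow_sub_mul_pow _ (hle s hs e).le]
      have := pow_ne_zero (s e) (hP2 e)
      field_simp
    rw [VanishesAt, hqeval, h, mul_eq_zero, mul_eq_zero]
    rw [or_iff_right (Finset.prod_ne_zero_iff.2 fun v _ => hP0 v),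
      or_iff_right (Finset.prod_ne_zero_iff.2 fun e _ => pow_ne_zero _ (hP2 e))]
  have hdisc : ∀ Q ∈ discreteCellule k G, VanishesAt k q Q := by
    intro Q hQ
    by_cases hQ0 : ∀ v : V, (Q (Sum.inl v)).rep 0 ≠ 0
    · by_cases hQ2 : ∀ e : G.edgeSet, (Q (Sum.inr e)).rep 2 ≠ 0
      · rw [heval Q hQ0 hQ2]
        exact aeval_lineSlope_eq_zero hQ hQ0 hQ2 p hp
      · push Not at hQ2
        obtain ⟨e, he⟩ := hQ2
        rw [VanishesAt, hqeval]
        refine mul_eq_zero_of_right _ (Finset.sum_eq_zero fun s hs => mul_eq_zero_of_right _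
          (Finset.prod_eq_zero (Finset.mem_univ e) ?_))
        rw [he, zero_pow (Nat.sub_pos_of_lt (hle s hs e)).ne', mul_zero]
    · push Not at hQ0
      obtain ⟨v, hv⟩ := hQ0
      rw [VanishesAt, hqeval, Finset.prod_eq_zero (Finset.mem_univ v) hv, zero_mul]
  have hzero : MvPolynomial.map (algebraMap F k) p = 0 := by
    apply MvPolynomial.funext
    intro m
    obtain ⟨P, hP, rfl⟩ : m ∈ affineSlopeVariety k G := h ▸ Set.mem_univ m
    rw [map_zero, MvPolynomial.eval_map, ← MvPolynomial.aeval_def]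
    rw [← heval P hP.2.2.1 hP.2.2.2]
    exact mem_zariskiClosure_iff.1 hP.1 q _ hq hdisc
  exact MvPolynomial.map_injective _ (algebraMap F k).injective (by rw [hzero, map_zero])

end Slopes

/-- Independence in the slope-rigidity matroid is Laman's condition, whatever the field. -/
theorem slopeRigidityMatroid_indep_edgeSet_iff_isLamanSparse (F : Type*) [Field F] {V : Type*}
    [Finite V] (G : SimpleGraph V) :
    (slopeRigidityMatroid F V).Indep G.edgeSet ↔ IsLamanSparse G := by
  rw [slopeRigidityMatroid_indep_edgeSet_iff]
  exact ⟨isLamanSparse_of_algebraicIndependent_ratSlope, fun h =>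
    algebraicIndependent_ratSlope_of_affineSlopeVariety_eq_univ (k := AlgebraicClosure F)
      (affineSlopeVariety_eq_univ h.pictureVariety_eq)⟩

end GraphVariety

theorem theorem4p1 {k : Type*} [Field k] [IsAlgClosed k] {F : Type*} [Field F]
    {V : Type*} [Finite V] (G : SimpleGraph V) :
    List.TFAE
      [(GraphVariety.lengthRigidityMatroid V).Indep G.edgeSet,
       (GraphVariety.slopeRigidityMatroid F V).Indep G.edgeSet,
       GraphVariety.affineSlopeVariety k G = Set.univ,
       GraphVariety.pictureVariety k G = GraphVariety.pictureSpace k G] := by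
  have hlaman : (GraphVariety.slopeRigidityMatroid F V).Indep G.edgeSet ↔
      GraphVariety.IsLamanSparse G :=
    GraphVariety.slopeRigidityMatroid_indep_edgeSet_iff_isLamanSparse F G
  tfae_have 1 ↔ 2 := by
    rw [GraphVariety.lengthRigidityMatroid_indep_edgeSet_iff, hlaman,
      GraphVariety.slopeRigidityMatroid_indep_edgeSet_iff_isLamanSparse]
  tfae_have 2 → 4 := fun h => (hlaman.1 h).pictureVariety_eq
  tfae_have 4 → 3 := GraphVariety.affineSlopeVariety_eq_univ
  tfae_have 3 → 2 := fun h => hlaman.2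
    (GraphVariety.isLamanSparse_of_algebraicIndependent_ratSlope
      (GraphVariety.algebraicIndependent_ratSlope_of_affineSlopeVariety_eq_univ (F := k) h))
  tfae_finish
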